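/- All Hilbert spaces are finite-dimensional complex Hilbert spaces with a fixed orthonormal basis, tensor products carry the product basis, and $\bar M$ denotes entrywise complex conjugation of $M$ in that basis. $\mathcal B(\mathcal H)$ denotes the linear operators on $\mathcal H$. A map $\mathcal F:\mathcal B(\mathcal H)\to\mathcal B(\mathcal K)$ is an \emph{encoding} if (1) for all Hermitian $A,B$ and all $p\in[0,1]$, $\mathcal F(A)$ is Hermitian, $\operatorname{spec}\mathcal F(A)=\operatorname{spec}A$ and $\mathcal F(pA+(1-p)B)=p\mathcal F(A)+(1-p)\mathcal F(B)$; and (2) on all of $\mathcal B(\mathcal H)$ it satisfies $\mathcal F(\mathbb 1)=\mathbb 1$, $\mathcal F(A^\dagger)=\mathcal F(A)^\dagger$, $\mathcal F(A+B)=\mathcal F(A)+\mathcal F(B)$, $\mathcal F(AB)=\mathcal F(A)\mathcal F(B)$ and $\mathcal F(xA)=x\mathcal F(A)$ for $x\in\mathbb R$. A map $\mathcal E:\mathcal B(\mathcal H)\to\mathcal B(\mathcal H')$ is a \emph{subspace encoding} if there is a subspace $S\subseteq\mathcal H'$ such that every $\mathcal E(M)$ is supported on $S$ (it maps $\mathcal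 H'$ into $S$ and annihilates $S^\perp$) and $M\mapsto\mathcal E(M)|_S$ is an encoding $\mathcal B(\mathcal H)\to\mathcal B(S)$. If $\mathcal H=\bigotimes_{j=1}^n\mathcal H_j$ and $\mathcal H'=\bigotimes_{j=1}^n\mathcal H'_j$, a subspace encoding $\mathcal E$ is \emph{local} if for every $j$ and every Hermitian $A_j$ on $\mathcal H_j$ there is a Hermitian $A'_j$ on $\mathcal H'_j$ with $\mathcal E(A_j\otimes\mathbb 1)=(A'_j\otimes\mathbb 1)\,\mathcal E(\mathbb 1)$. \textbf{Theorem.} Let $\dim\mathcal H_j\ge 2$ for all $j$. A map $\mathcal E:\mathcal B(\bigotimes_{j=1}^n\mathcal H_j)\to\mathcal B(\bigotimes_{j=1}^n\mathcal H'_j)$ is a local subspace encoding if and only if there exist $n$ ancilla systems $E_1,\dots,E_n$ such that, for all $M$, $$\mathcal E(M)=V\left(M\otimes P+\bar M\otimes Q\right)V^\dagger,$$ where \begin{itemize} \item $V=\bigotimes_j V_j$ for isometries $V_j:\mathcal H_j\otimes E_j\to\mathcal H'_j$; \item $P$ and $Q$ are mutually orthogonal projectors (orthogonal projections with $PQ=0$),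 not both zero, on $E=\bigotimes_j E_j$, and they are locally distinguishable: for every $j$ there are mutually orthogonal projectors $P_{E_j}$ and $Q_{E_j}$ on $E_j$ with $(P_{E_j}\otimes\mathbb 1)P=P$ and $(Q_{E_j}\otimes\mathbb 1)Q=Q$. \end{itemize} -/

import Mathlib

open scoped Matrix Kronecker

noncomputable section

namespace HamEnc

/-- A map `E : B(ℂ^k) → B(K)` into the operators on a finite-dimensional Hilbert space `K` is an
*encoding*: on Hermitian operators it preserves Hermiticity, spectrum and convex combinations, and
on all of `B(ℂ^k)` it is the extension of its Hermitian part to a unital, adjoint-preserving,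
additive, multiplicative and real-homogeneous map. -/
structure IsEncoding {k K : Type*} [Fintype k] [DecidableEq k]
    [NormedAddCommGroup K] [InnerProductSpace ℂ K] [FiniteDimensional ℂ K]
    (E : Matrix k k ℂ → (K →ₗ[ℂ] K)) : Prop where
  isSelfAdjoint : ∀ A, A.IsHermitian → IsSelfAdjoint (E A)
  spectrum_eq : ∀ A, A.IsHermitian → spectrum ℂ (E A) = spectrum ℂ A
  convex : ∀ A B, A.IsHermitian → B.IsHermitian → ∀ p : ℝ, 0 ≤ p → p ≤ 1 →
    E ((p : ℂ) • A + (1 - p : ℂ) • B) = (p : ℂ) • E A + (1 - p : ℂ) • E B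
  map_one : E 1 = 1
  map_conjTranspose : ∀ A, E Aᴴ = LinearMap.adjoint (E A)
  map_add : ∀ A B, E (A + B) = E A + E B
  map_mul : ∀ A B, E (A * B) = E A * E B
  map_real_smul : ∀ (x : ℝ) A, E ((x : ℂ) • A) = (x : ℂ) • E A

/-- The operator `X` on `ℂ^m` has support only on the subspace `S`: it maps into `S` and
annihilates the orthogonal complement of `S`. -/
def SupportedOn {m : Type*} [Fintype m] [DecidableEq m]
    (S : Submodule ℂ (EuclideanSpace ℂ m)) (X : Matrix m m ℂ) : Prop :=
  (∀ v, Matrix.toEuclideanLin X v ∈ S) ∧ ∀ v ∈ Sᗮ, Matrix.toEuclideanLin X v = 0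

/-- `X|_S` as an operator on `S`. The outer projection onto `S` changes nothing when `X` maps
`S` into `S`; it is there to land in `S`. -/
def restrictTo {m : Type*} [Fintype m] [DecidableEq m]
    (S : Submodule ℂ (EuclideanSpace ℂ m)) (X : Matrix m m ℂ) : S →ₗ[ℂ] S :=
  S.orthogonalProjectionOnto.toLinearMap ∘ₗ Matrix.toEuclideanLin X ∘ₗ S.subtype

/-- `E : B(ℂ^k) → B(ℂ^m)` is an encoding into the subspace `S` of `ℂ^m`. -/
def IsEncodingInto {k m : Type*} [Fintype k] [DecidableEq k] [Fintype m] [DecidableEq m]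
    (S : Submodule ℂ (EuclideanSpace ℂ m)) (E : Matrix k k ℂ → Matrix m m ℂ) : Prop :=
  (∀ M, SupportedOn S (E M)) ∧ IsEncoding (K := S) fun M => restrictTo S (E M)

/-- `E` is a subspace encoding: an encoding into some subspace. -/
def IsSubspaceEncoding {k m : Type*} [Fintype k] [DecidableEq k] [Fintype m] [DecidableEq m]
    (E : Matrix k k ℂ → Matrix m m ℂ) : Prop :=
  ∃ S : Submodule ℂ (EuclideanSpace ℂ m), IsEncodingInto S E

/-- Index set of the standard product basis of `⨂ j, ℂ^(d j)`. -/
abbrev Idx {n : ℕ} (d : Fin n → ℕ) : Type := (j : Fin n) → Fin (d j)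

/-- The tensor product `⨂ j, A j` in the standard product bases. -/
def tensor {n : ℕ} {ρ σ : Fin n → Type} (A : (j : Fin n) → Matrix (ρ j) (σ j) ℂ) :
    Matrix ((j : Fin n) → ρ j) ((j : Fin n) → σ j) ℂ :=
  Matrix.of fun x y => ∏ j, A j (x j) (y j)

/-- `A ⊗ 1`: the operator `A` acting on site `j`, extended by the identity on all other sites. -/
def onSite {n : ℕ} {d : Fin n → ℕ} (j : Fin n) (A : Matrix (Fin (d j)) (Fin (d j)) ℂ) :
    Matrix (Idx d) (Idx d) ℂ :=
  tensor (Function.update (fun i => (1 : Matrix (Fin (d i)) (Fin (d i)) ℂ)) j A)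

/-- `E : B(⨂ j, ℂ^(d j)) → B(⨂ j, ℂ^(d' j))` is a local subspace encoding. -/
def IsLocalSubspaceEncoding {n : ℕ} {d d' : Fin n → ℕ}
    (E : Matrix (Idx d) (Idx d) ℂ → Matrix (Idx d') (Idx d') ℂ) : Prop :=
  IsSubspaceEncoding E ∧
    ∀ (j : Fin n) (A : Matrix (Fin (d j)) (Fin (d j)) ℂ), A.IsHermitian →
      ∃ A' : Matrix (Fin (d' j)) (Fin (d' j)) ℂ, A'.IsHermitian ∧
        E (onSite j A) = onSite j A' * E 1

/-- The tensor product `⨂ j, V j` of maps `V j : ℂ^(d j) ⊗ ℂ^(e j) → ℂ^(d' j)`, with its domain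
rearranged to `(⨂ j, ℂ^(d j)) ⊗ (⨂ j, ℂ^(e j))`. -/
def tensorPaired {n : ℕ} {d e d' : Fin n → ℕ}
    (V : (j : Fin n) → Matrix (Fin (d' j)) (Fin (d j) × Fin (e j)) ℂ) :
    Matrix (Idx d') (Idx d × Idx e) ℂ :=
  (tensor V).submatrix id fun ab j => (ab.1 j, ab.2 j)

/-- The projectors `P`, `Q` on `⨂ j, ℂ^(e j)` can be told apart at every single site: for each `j`
there are mutually orthogonal projectors on `ℂ^(e j)`, one fixing `P` and the other fixing `Q`. -/
def LocallyDistinguishable {n : ℕ} {e : Fin n → ℕ} (P Q : Matrix (Idx e) (Idx e) ℂ) : Prop :=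
  ∀ j : Fin n, ∃ p q : Matrix (Fin (e j)) (Fin (e j)) ℂ,
    IsStarProjection p ∧ IsStarProjection q ∧ p * q = 0 ∧
      onSite j p * P = P ∧ onSite j q * Q = Q

end HamEnc

end

/-! The encoding laws make `E` a nonzero homomorphism of real star-algebras. It need not commute
with `i`, but `J = E(i·1)` commutes with the image and `J² = -E(1)`. The eigenspaces of `J` for `i`
and `-i` split `E` into a complex-linear and an antilinear part with orthogonal supports. `linPart`,
applied to `E` and to `E` after conjugation, describes both by complex-linear homomorphisms.

Locality is used site by site. As `dim H_j ≥ 2`, Hermitian operators generate the site algebra as a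
ring (`hermitian_induction`), so every site operator has a local image. Cut down to the support of
`E(1)` at site `j`, this image is unique and gives a real star-homomorphism `φ_j`
(`exists_siteHom`). Matrix units turn `φ_j` into an isometry `V_j` and orthogonal projections `p_j`,
`q_j` for its linear and antilinear parts (`exists_isometry_linPart`).

Let `T = ⨂ V_j`, let `F` be one of the two complex-linear homomorphisms, and put `R = T† F(1) T`.
Since single-site operators generate everything, `T† F(M) T = (M ⊗ 1) R`; taking adjoints, `R`
commutes with all `M ⊗ 1`, so `R = 1 ⊗ P` (`exists_multiplicity_projection`). The other one gives
`Q` with the same `T`, and `p_j`, `q_j` witness local distinguishability.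

Conversely, the formula defines an injective real star-homomorphism. Injectivity makes it preserve
and reflect invertibility, hence real spectra (`isEncoding_of_injective`). The local image of `A` is
`V_j (A ⊗ p_j + Ā ⊗ q_j) V_j†`. -/

namespace HamEnc

/-! ### Product operators and single-site operators -/

section Tensor

variable {n : ℕ}

theorem tensor_mul {ρ σ τ : Fin n → Type} [∀ j, Fintype (σ j)]
    (A : (j : Fin n) → Matrix (ρ j) (σ j) ℂ) (B : (j : Fin n) → Matrix (σ j) (τ j) ℂ) :
    tensor A * tensor B = tensor fun j => A j * B j := by
  ext x z
  simp only [tensor, Matrix.mul_apply, Matrix.of_apply, ← Finset.prod_mul_distrib]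
  rw [Finset.prod_univ_sum, Fintype.piFinset_univ]

theorem tensor_one {ρ : Fin n → Type} [∀ j, DecidableEq (ρ j)] :
    tensor (fun j => (1 : Matrix (ρ j) (ρ j) ℂ)) = 1 := by
  ext x y
  simp only [tensor, Matrix.of_apply, Matrix.one_apply]
  rw [Finset.prod_ite_zero]
  simp [funext_iff]

theorem tensor_conjTranspose {ρ σ : Fin n → Type} (A : (j : Fin n) → Matrix (ρ j) (σ j) ℂ) :
    (tensor A)ᴴ = tensor fun j => (A j)ᴴ := by
  ext x y
  simp [tensor, Matrix.conjTranspose_apply]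

theorem tensor_single {d : Fin n → ℕ} (x y : Idx d) :
    tensor (fun j => Matrix.single (x j) (y j) (1 : ℂ)) = Matrix.single x y 1 := by
  ext a b
  simp only [tensor, Matrix.of_apply, Matrix.single_apply]
  rw [Finset.prod_ite_zero]
  simp [funext_iff, forall_and]

variable {d : Fin n → ℕ}

theorem onSite_apply (j : Fin n) (A : Matrix (Fin (d j)) (Fin (d j)) ℂ) (x y : Idx d) :
    onSite j A x y = A (x j) (y j) *
      ∏ i ∈ Finset.univ.erase j, (1 : Matrix (Fin (d i)) (Fin (d i)) ℂ) (x i) (y i) := by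
  simp only [onSite, tensor, Matrix.of_apply]
  rw [← Finset.mul_prod_erase _ _ (Finset.mem_univ j)]
  congr 1
  · simp
  · refine Finset.prod_congr rfl fun i hi => ?_
    rw [Function.update_of_ne (Finset.ne_of_mem_erase hi)]

theorem onSite_add (j : Fin n) (A B : Matrix (Fin (d j)) (Fin (d j)) ℂ) :
    onSite j (A + B) = onSite j A + onSite j B := by
  ext x y
  simp [onSite_apply, add_mul]

theorem onSite_smul (j : Fin n) (c : ℂ) (A : Matrix (Fin (d j)) (Fin (d j)) ℂ) :
    onSite j (c • A) = c • onSite j A := by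
  ext x y
  simp [onSite_apply, mul_assoc]

theorem onSite_zero (j : Fin n) :
    onSite j (0 : Matrix (Fin (d j)) (Fin (d j)) ℂ) = 0 := by
  ext x y
  simp [onSite_apply]

theorem onSite_sub (j : Fin n) (A B : Matrix (Fin (d j)) (Fin (d j)) ℂ) :
    onSite j (A - B) = onSite j A - onSite j B := by
  ext x y
  simp [onSite_apply, sub_mul]

theorem onSite_mul (j : Fin n) (A B : Matrix (Fin (d j)) (Fin (d j)) ℂ) :
    onSite j (A * B) = onSite j A * onSite j B := by
  rw [onSite, onSite, onSite, tensor_mul]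
  congr 1
  funext i
  rcases eq_or_ne i j with rfl | h
  · simp
  · simp [Function.update_of_ne h]

theorem onSite_one (j : Fin n) :
    onSite j (1 : Matrix (Fin (d j)) (Fin (d j)) ℂ) = 1 := by
  rw [onSite, Function.update_eq_self_iff.2 rfl, tensor_one]

theorem onSite_conjTranspose (j : Fin n) (A : Matrix (Fin (d j)) (Fin (d j)) ℂ) :
    (onSite j A)ᴴ = onSite j Aᴴ := by
  rw [onSite, onSite, tensor_conjTranspose]
  congr 1
  funext i
  rcases eq_or_ne i j with rfl | h
  · simp
  · simp [Function.update_of_ne h]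

theorem onSite_map_star (j : Fin n) (A : Matrix (Fin (d j)) (Fin (d j)) ℂ) :
    onSite j (A.map star) = (onSite j A).map star := by
  ext x y
  simp only [onSite_apply, Matrix.map_apply, star_mul', star_prod]
  congr 1
  refine Finset.prod_congr rfl fun i _ => ?_
  simp [Matrix.one_apply, apply_ite]

/-- Only indices that agree with `x` off site `j` contribute. Thus `onSite j A` acts on each slice
of `M` along site `j` separately, which is what the support projection at a site relies on. -/
theorem onSite_mul_apply {κ : Type*} (j : Fin n) (A : Matrix (Fin (d j)) (Fin (d j)) ℂ)
    (M : Matrix (Idx d) κ ℂ) (x : Idx d) (z : κ) :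
    (onSite j A * M) x z = ∑ a, A (x j) a * M (Function.update x j a) z := by
  rw [Matrix.mul_apply]
  symm
  refine Finset.sum_of_injOn (fun a => Function.update x j a)
    (fun a _ b _ h => Function.update_injective x j h) (by simp) ?_ ?_
  · intro y _ hy
    rw [onSite_apply]
    obtain ⟨i, hij, hi⟩ : ∃ i, i ≠ j ∧ x i ≠ y i := by
      by_contra! h
      refine hy ⟨y j, by simp, ?_⟩
      funext i
      rcases eq_or_ne i j with rfl | hij
      · simp
      · simp [Function.update_of_ne hij, h i hij]
    have h0 : ∏ i ∈ Finset.univ.erase j,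
        (1 : Matrix (Fin (d i)) (Fin (d i)) ℂ) (x i) (y i) = 0 :=
      Finset.prod_eq_zero (Finset.mem_erase.2 ⟨hij, Finset.mem_univ i⟩) (Matrix.one_apply_ne hi)
    rw [h0, mul_zero, zero_mul]
  · intro a _
    rw [onSite_apply, Finset.prod_eq_one]
    · simp
    · intro i hi
      rw [Function.update_of_ne (Finset.ne_of_mem_erase hi), Matrix.one_apply_eq]

/-- A multiplicatively closed property of operators which holds at `1` and at single-site operators
holds at product operators. -/
theorem tensor_induction {p : Matrix (Idx d) (Idx d) ℂ → Prop} (one : p 1)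
    (mul : ∀ A B, p A → p B → p (A * B))
    (A : (j : Fin n) → Matrix (Fin (d j)) (Fin (d j)) ℂ) (site : ∀ j, p (onSite j (A j))) :
    p (tensor A) := by
  have key : ∀ s : Finset (Fin n), p (tensor (s.piecewise A fun _ => 1)) := by
    intro s
    induction s using Finset.induction_on with
    | empty => simpa [tensor_one] using one
    | insert j s hj ih =>
      convert mul _ _ (site j) ih using 1
      rw [onSite, tensor_mul]
      congr 1
      funext i
      rcases eq_or_ne i j with rfl | h
      · simp [Finset.piecewise, hj]
      · simp [Finset.piecewise, h]
  simpa using key Finset.univ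

/-- The single-site operators generate all operators. -/
theorem matrix_induction_onSite {p : Matrix (Idx d) (Idx d) ℂ → Prop} (one : p 1)
    (add : ∀ A B, p A → p B → p (A + B)) (smul : ∀ (c : ℂ) A, p A → p (c • A))
    (mul : ∀ A B, p A → p B → p (A * B))
    (site : ∀ j (A : Matrix (Fin (d j)) (Fin (d j)) ℂ), p (onSite j A))
    (M : Matrix (Idx d) (Idx d) ℂ) : p M := by
  have zero : p 0 := by simpa using smul 0 1 one
  rw [Matrix.matrix_eq_sum_single M]
  refine Finset.sum_induction _ p add zero fun x _ =>
    Finset.sum_induction _ p add zero fun y _ => ?_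
  -- A matrix unit of the product basis is a product of single-site matrix units.
  have h := smul (M x y) _ (tensor_induction one mul
    (fun j => Matrix.single (x j) (y j) (1 : ℂ)) fun j => site j _)
  rwa [tensor_single, Matrix.smul_single, smul_eq_mul, mul_one] at h

theorem tensor_mul_eq_self {κ : Type*} (A : (j : Fin n) → Matrix (Fin (d j)) (Fin (d j)) ℂ)
    (R : Matrix (Idx d) κ ℂ) (h : ∀ j, onSite j (A j) * R = R) : tensor A * R = R :=
  tensor_induction (p := fun X => X * R = R) (Matrix.one_mul R)
    (fun X Y hX hY => by rw [Matrix.mul_assoc, hY, hX]) A h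

variable {e d' : Fin n → ℕ}

theorem tensor_kronecker (A : (j : Fin n) → Matrix (Fin (d j)) (Fin (d j)) ℂ)
    (B : (j : Fin n) → Matrix (Fin (e j)) (Fin (e j)) ℂ) :
    tensor A ⊗ₖ tensor B = (tensor fun j => A j ⊗ₖ B j).submatrix
      (fun ab j => (ab.1 j, ab.2 j)) (fun ab j => (ab.1 j, ab.2 j)) := by
  ext x y
  simp [tensor, Matrix.kroneckerMap_apply, Finset.prod_mul_distrib]

/-- Regrouping of the indices of `(⨂ j, ℂ^(d j)) ⊗ (⨂ j, ℂ^(e j))` by sites. -/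
def pairEquiv (d e : Fin n → ℕ) : Idx d × Idx e ≃ ((j : Fin n) → Fin (d j) × Fin (e j)) where
  toFun ab j := (ab.1 j, ab.2 j)
  invFun f := (fun j => (f j).1, fun j => (f j).2)
  left_inv _ := rfl
  right_inv _ := rfl

theorem tensorPaired_conjTranspose_mul_self
    (V : (j : Fin n) → Matrix (Fin (d' j)) (Fin (d j) × Fin (e j)) ℂ)
    (hV : ∀ j, (V j)ᴴ * V j = 1) : (tensorPaired V)ᴴ * tensorPaired V = 1 := by
  change ((tensor V).submatrix id (pairEquiv d e))ᴴ * (tensor V).submatrix id (pairEquiv d e) = 1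
  rw [Matrix.conjTranspose_submatrix, ← Equiv.coe_refl, Matrix.submatrix_mul_equiv,
    tensor_conjTranspose, tensor_mul]
  simp [hV, tensor_one]

theorem tensorPaired_mul_conjTranspose
    (V : (j : Fin n) → Matrix (Fin (d' j)) (Fin (d j) × Fin (e j)) ℂ) :
    tensorPaired V * (tensorPaired V)ᴴ = tensor fun j => V j * (V j)ᴴ := by
  change (tensor V).submatrix id (pairEquiv d e) * ((tensor V).submatrix id (pairEquiv d e))ᴴ = _
  rw [Matrix.conjTranspose_submatrix, Matrix.submatrix_mul_equiv,
    tensor_conjTranspose, tensor_mul]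
  rfl

theorem tensorPaired_mul_kronecker
    (V : (j : Fin n) → Matrix (Fin (d' j)) (Fin (d j) × Fin (e j)) ℂ)
    (A : (j : Fin n) → Matrix (Fin (d j)) (Fin (d j)) ℂ)
    (B : (j : Fin n) → Matrix (Fin (e j)) (Fin (e j)) ℂ) :
    tensorPaired V * (tensor A ⊗ₖ tensor B) = tensorPaired fun j => V j * (A j ⊗ₖ B j) := by
  rw [tensor_kronecker]
  change (tensor V).submatrix id (pairEquiv d e) *
    (tensor fun j => A j ⊗ₖ B j).submatrix (pairEquiv d e) (pairEquiv d e) = _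
  rw [Matrix.submatrix_mul_equiv, tensor_mul]
  rfl

theorem onSite_mul_tensorPaired (j : Fin n) (X : Matrix (Fin (d' j)) (Fin (d' j)) ℂ)
    (V : (j : Fin n) → Matrix (Fin (d' j)) (Fin (d j) × Fin (e j)) ℂ) :
    onSite j X * tensorPaired V = tensorPaired (Function.update V j (X * V j)) := by
  change (onSite j X).submatrix id (Equiv.refl _) * (tensor V).submatrix (Equiv.refl _) _ = _
  rw [Matrix.submatrix_mul_equiv, onSite, tensor_mul]
  rw [tensorPaired]
  congr 2
  funext i
  rcases eq_or_ne i j with rfl | h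
  · simp
  · simp [Function.update_of_ne h]

/-- A single-site operator which `V j` intertwines with `A ⊗ B` is intertwined with `A ⊗ B` by the
whole product of the `V j`. -/
theorem onSite_mul_tensorPaired_of_intertwine (j : Fin n)
    (V : (j : Fin n) → Matrix (Fin (d' j)) (Fin (d j) × Fin (e j)) ℂ)
    (X : Matrix (Fin (d' j)) (Fin (d' j)) ℂ)
    (A : Matrix (Fin (d j)) (Fin (d j)) ℂ) (B : Matrix (Fin (e j)) (Fin (e j)) ℂ)
    (h : X * V j = V j * (A ⊗ₖ B)) :
    onSite j X * tensorPaired V = tensorPaired V * (onSite j A ⊗ₖ onSite j B) := by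
  rw [onSite_mul_tensorPaired, onSite, onSite, tensorPaired_mul_kronecker, h]
  congr 1
  funext i
  rcases eq_or_ne i j with rfl | h
  · simp
  · simp [Function.update_of_ne h]

end Tensor

/-! ### The commutant of `B(ℂ^k) ⊗ 1` -/

section Kronecker

theorem one_kronecker_injective {k l : Type*} [DecidableEq k] [Nonempty k] :
    Function.Injective fun B : Matrix l l ℂ => (1 : Matrix k k ℂ) ⊗ₖ B := by
  intro B C h
  obtain ⟨a⟩ := ‹Nonempty k›
  ext x y
  simpa using congrFun (congrFun h (a, x)) (a, y)

/-- The commutant of `B(ℂ^k) ⊗ 1` is `1 ⊗ B(ℂ^l)`. -/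
theorem exists_eq_one_kronecker_of_commute {k l : Type*} [Fintype k] [DecidableEq k]
    [Fintype l] [DecidableEq l] [Nonempty k] (R : Matrix (k × l) (k × l) ℂ)
    (h : ∀ M : Matrix k k ℂ, (M ⊗ₖ (1 : Matrix l l ℂ)) * R = R * (M ⊗ₖ (1 : Matrix l l ℂ))) :
    ∃ P : Matrix l l ℂ, R = (1 : Matrix k k ℂ) ⊗ₖ P := by
  obtain ⟨o⟩ := ‹Nonempty k›
  refine ⟨Matrix.of fun b b' => R (o, b) (o, b'), ?_⟩
  ext ⟨a, b⟩ ⟨a', b'⟩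
  -- Commuting with the matrix unit `e_oa` forces `R (a, b) (a', b') = δ_aa' R (o, b) (o, b')`.
  have h1 := congrFun (congrFun (h (Matrix.single o a 1)) (o, b)) (a', b')
  simp only [Matrix.mul_apply, Fintype.sum_prod_type, Matrix.kroneckerMap_apply,
    Matrix.single_apply, Matrix.one_apply, mul_ite, ite_mul, mul_one, one_mul, mul_zero,
    zero_mul] at h1
  simp only [Matrix.kroneckerMap_apply, Matrix.one_apply, Matrix.of_apply]
  simp [ite_and] at h1
  simpa using h1

end Kronecker

noncomputable section

/-! ### Splitting a real homomorphism into linear and antilinear parts -/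

section LinPart

variable {k m : Type*} [Fintype k] [Fintype m]

/-- Entrywise complex conjugation, as a homomorphism of real star-algebras. -/
def conjHom (k : Type*) [Fintype k] :
    Matrix k k ℂ →⋆ₙₐ[ℝ] Matrix k k ℂ where
  toFun M := M.map star
  map_smul' c M := by ext; simp
  map_zero' := by ext; simp
  map_add' M N := by ext; simp
  map_mul' M N := by ext; simp [Matrix.mul_apply]
  map_star' M := by ext; simp [Matrix.star_apply]

@[simp]
theorem conjHom_apply (M : Matrix k k ℂ) : conjHom k M = M.map star := rfl

theorem conjHom_conjHom (M : Matrix k k ℂ) : conjHom k (conjHom k M) = M := by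
  ext; simp

theorem conjHom_I_smul (M : Matrix k k ℂ) :
    conjHom k (Complex.I • M) = -(Complex.I • conjHom k M) := by
  ext; simp

theorem complex_smul_eq {k : Type*} (c : ℂ) (M : Matrix k k ℂ) :
    c • M = c.re • M + c.im • (Complex.I • M) := by
  ext a b
  simp only [Matrix.smul_apply, Matrix.add_apply, Complex.real_smul, smul_eq_mul]
  conv_lhs => rw [← Complex.re_add_im c]
  ring

theorem I_smul_I_smul {k : Type*} (M : Matrix k k ℂ) : Complex.I • (Complex.I • M) = -M := by
  rw [smul_smul, Complex.I_mul_I, neg_one_smul]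

/-- The complex-linear part of a homomorphism of real star-algebras. -/
def linPart (φ : Matrix k k ℂ →⋆ₙₐ[ℝ] Matrix m m ℂ) : Matrix k k ℂ →⋆ₙₐ[ℂ] Matrix m m ℂ where
  toFun M := (1 / 2 : ℂ) • (φ M - Complex.I • φ (Complex.I • M))
  map_zero' := by simp
  map_add' M N := by
    simp only [smul_add, map_add]
    module
  map_smul' c M := by
    have h1 : φ (Complex.I • c • M) = c.re • φ (Complex.I • M) - c.im • φ M := by
      rw [smul_comm, complex_smul_eq c, I_smul_I_smul, map_add, map_smul φ c.re,
        map_smul φ c.im, map_neg, smul_neg, sub_eq_add_neg]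
    have h2 : φ (c • M) = c.re • φ M + c.im • φ (Complex.I • M) := by
      rw [complex_smul_eq c, map_add, map_smul, map_smul]
    simp only [h1, h2, MonoidHom.id_apply]
    ext a b
    simp only [Matrix.smul_apply, Matrix.add_apply, Matrix.sub_apply, Complex.real_smul,
      smul_eq_mul]
    conv_rhs => rw [← Complex.re_add_im c]
    linear_combination (1 / 2 * (c.im : ℂ) * φ (Complex.I • M) a b) * Complex.I_mul_I
  map_mul' M N := by
    have h : φ (Complex.I • M) * φ (Complex.I • N) = -φ (M * N) := by
      rw [← map_mul, Matrix.smul_mul, Matrix.mul_smul, I_smul_I_smul, map_neg]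
    have h1 : φ M * φ (Complex.I • N) = φ (Complex.I • (M * N)) := by
      rw [← map_mul, Matrix.mul_smul]
    have h2 : φ (Complex.I • M) * φ N = φ (Complex.I • (M * N)) := by
      rw [← map_mul, Matrix.smul_mul]
    simp only [Matrix.smul_mul, Matrix.mul_smul, sub_mul, mul_sub, h, h1, h2, ← map_mul φ M N,
      smul_neg, smul_sub]
    match_scalars <;> grind [Complex.I_sq]
  map_star' M := by
    have h : φ (Complex.I • star M) = -star (φ (Complex.I • M)) := by
      rw [← map_star, star_smul, ← map_neg]
      simp
    simp [h, map_star]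

theorem linPart_apply (φ : Matrix k k ℂ →⋆ₙₐ[ℝ] Matrix m m ℂ) (M : Matrix k k ℂ) :
    linPart φ M = (1 / 2 : ℂ) • (φ M - Complex.I • φ (Complex.I • M)) := rfl

theorem linPart_conj_apply (φ : Matrix k k ℂ →⋆ₙₐ[ℝ] Matrix m m ℂ) (M : Matrix k k ℂ) :
    linPart (φ.comp (conjHom k)) M =
      (1 / 2 : ℂ) • (φ (conjHom k M) + Complex.I • φ (Complex.I • conjHom k M)) := by
  rw [linPart_apply, NonUnitalStarAlgHom.comp_apply, NonUnitalStarAlgHom.comp_apply,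
    conjHom_I_smul, map_neg, smul_neg, sub_neg_eq_add]

theorem linPart_add_linPart_conj (φ : Matrix k k ℂ →⋆ₙₐ[ℝ] Matrix m m ℂ) (M : Matrix k k ℂ) :
    linPart φ M + linPart (φ.comp (conjHom k)) (M.map star) = φ M := by
  rw [linPart_conj_apply, ← conjHom_apply, conjHom_conjHom, linPart_apply]
  module

/-- The two factors live on the `i` and `-i` eigenspaces of `φ(i·1)`. In the expansion, `φ(iM) φ(iN)
= -φ(MN)` cancels the first term and the two mixed terms cancel each other. -/
theorem linPart_mul_linPart_conj (φ : Matrix k k ℂ →⋆ₙₐ[ℝ] Matrix m m ℂ) (M N : Matrix k k ℂ) :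
    linPart φ M * linPart (φ.comp (conjHom k)) N = 0 := by
  rw [linPart_conj_apply, linPart_apply]
  generalize conjHom k N = N
  have h : φ (Complex.I • M) * φ (Complex.I • N) = -φ (M * N) := by
    rw [← map_mul, Matrix.smul_mul, Matrix.mul_smul, I_smul_I_smul, map_neg]
  have h1 : φ M * φ (Complex.I • N) = φ (Complex.I • (M * N)) := by
    rw [← map_mul, Matrix.mul_smul]
  have h2 : φ (Complex.I • M) * φ N = φ (Complex.I • (M * N)) := by
    rw [← map_mul, Matrix.smul_mul]
  simp only [Matrix.smul_mul, Matrix.mul_smul, sub_mul, mul_add, h, h1, h2, ← map_mul φ M N,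
    smul_neg, smul_add]
  match_scalars <;> grind [Complex.I_sq]

theorem map_mul_linPart (φ : Matrix k k ℂ →⋆ₙₐ[ℝ] Matrix m m ℂ) (M N : Matrix k k ℂ) :
    φ M * linPart φ N = linPart φ (M * N) := by
  simp only [linPart_apply, Matrix.mul_smul, mul_sub, ← map_mul]

theorem linPart_mul_map (φ : Matrix k k ℂ →⋆ₙₐ[ℝ] Matrix m m ℂ) (M N : Matrix k k ℂ) :
    linPart φ M * φ N = linPart φ (M * N) := by
  simp only [linPart_apply, Matrix.smul_mul, sub_mul, ← map_mul]

end LinPart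

theorem isStarProjection_map {R A B : Type*} [Monoid R] [NonUnitalSemiring A]
    [DistribMulAction R A] [StarRing A] [NonUnitalSemiring B] [DistribMulAction R B] [StarRing B]
    (F : A →⋆ₙₐ[R] B) {a : A} (ha : IsStarProjection a) : IsStarProjection (F a) :=
  ⟨by rw [IsIdempotentElem, ← map_mul, ha.isIdempotentElem.eq],
   by rw [IsSelfAdjoint, ← map_star, ha.isSelfAdjoint.star_eq]⟩

/-! ### Representations of a full matrix algebra -/

section Isometry

theorem columnBlocks_mul_kronecker {m k l : Type*} [Fintype k] [Fintype l]
    (B : k → Matrix m l ℂ) (M : Matrix k k ℂ) (c : Matrix l l ℂ) :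
    (Matrix.of fun x ab => B ab.1 x ab.2 : Matrix m (k × l) ℂ) * (M ⊗ₖ c) *
        (Matrix.of fun x ab => B ab.1 x ab.2 : Matrix m (k × l) ℂ)ᴴ =
      ∑ a, ∑ a', M a a' • (B a * c * (B a')ᴴ) := by
  ext x y
  simp only [Matrix.sum_apply, Matrix.smul_apply, Matrix.mul_apply, Fintype.sum_prod_type,
    Matrix.kroneckerMap_apply, Finset.sum_mul, Finset.mul_sum, smul_eq_mul,
    Matrix.conjTranspose_apply, Matrix.of_apply]
  conv_rhs => rw [Finset.sum_comm]
  refine Finset.sum_congr rfl fun a' _ => ?_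
  rw [Finset.sum_comm]
  refine Finset.sum_congr rfl fun a _ => Finset.sum_congr rfl fun b' _ =>
    Finset.sum_congr rfl fun b _ => ?_
  ring

variable {m : Type*} [Fintype m] [DecidableEq m]

/-- A projection is `W Wᴴ` for an isometry `W`. -/
theorem exists_isometry_of_isStarProjection (f : Matrix m m ℂ) (hf : IsStarProjection f) :
    ∃ (r : ℕ) (W : Matrix m (Fin r) ℂ), Wᴴ * W = 1 ∧ W * Wᴴ = f := by
  let K := LinearMap.range (Matrix.toEuclideanLin f)
  let b := stdOrthonormalBasis ℂ K
  let W : Matrix m (Fin (Module.finrank ℂ K)) ℂ := Matrix.of fun x i => (b i : EuclideanSpace ℂ m) x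
  have hfb : ∀ i, f *ᵥ (b i : EuclideanSpace ℂ m).ofLp = (b i : EuclideanSpace ℂ m).ofLp := by
    intro i
    obtain ⟨v, hv⟩ := (b i).2
    rw [← hv, Matrix.toLpLin_apply, Matrix.mulVec_mulVec, hf.isIdempotentElem.eq]
  have hfW : f * W = W := by
    ext x i
    exact congrFun (hfb i) x
  have hWW : Wᴴ * W = 1 := by
    ext i j
    have := (orthonormal_iff_ite.1 b.orthonormal) i j
    rw [Submodule.coe_inner, EuclideanSpace.inner_eq_star_dotProduct] at this
    rw [Matrix.one_apply, ← this, dotProduct_comm]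
    rfl
  refine ⟨_, W, hWW, ?_⟩
  have hWf : Wᴴ * f = Wᴴ := by
    conv_rhs => rw [← hfW]
    rw [Matrix.conjTranspose_mul, show fᴴ = f from hf.isSelfAdjoint]
  have hcol : ∀ v : m → ℂ, ∃ c, f *ᵥ v = W *ᵥ c := by
    intro v
    have hv : WithLp.toLp 2 (f *ᵥ v) ∈ K := ⟨WithLp.toLp 2 v, by simp⟩
    refine ⟨fun i => b.repr ⟨_, hv⟩ i, ?_⟩
    have h := congrArg (fun u : K => (u : EuclideanSpace ℂ m).ofLp) (b.sum_repr ⟨_, hv⟩)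
    simp only [Submodule.coe_sum, Submodule.coe_smul] at h
    refine h.symm.trans ?_
    ext x
    simp only [WithLp.ofLp_sum, Finset.sum_apply, WithLp.ofLp_smul, Pi.smul_apply, smul_eq_mul,
      Matrix.mulVec, dotProduct]
    exact Finset.sum_congr rfl fun i _ => mul_comm _ _
  refine Matrix.ext_of_mulVec_single fun j => ?_
  obtain ⟨c, hc⟩ := hcol (Pi.single j 1)
  rw [← hWf, ← Matrix.mul_assoc, ← Matrix.mulVec_mulVec, hc, Matrix.mulVec_mulVec, Matrix.mul_assoc,
    hWW, Matrix.mul_one]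

/-- Representation theory of `B(ℂ^k)`: a homomorphism of real star-algebras is a sum of copies of
the identity and of complex conjugation. -/
theorem exists_isometry_linPart {k : Type*} [Fintype k] [DecidableEq k] [Nonempty k]
    (φ : Matrix k k ℂ →⋆ₙₐ[ℝ] Matrix m m ℂ) :
    ∃ (e : ℕ) (V : Matrix m (k × Fin e) ℂ) (p q : Matrix (Fin e) (Fin e) ℂ),
      Vᴴ * V = 1 ∧ IsStarProjection p ∧ IsStarProjection q ∧ p * q = 0 ∧
      (∀ M, linPart φ M = V * (M ⊗ₖ p) * Vᴴ) ∧
      ∀ M, linPart (φ.comp (conjHom k)) M = V * (M ⊗ₖ q) * Vᴴ := by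
  obtain ⟨o⟩ := ‹Nonempty k›
  have hconj : ∀ a b : k, conjHom k (Matrix.single a b 1) = Matrix.single a b (1 : ℂ) := by
    intro a b
    ext x y
    simp [Matrix.single_apply, apply_ite]
  have hstar : ∀ a b : k, star (Matrix.single a b (1 : ℂ)) = Matrix.single b a 1 := by
    intro a b
    simp [Matrix.star_eq_conjTranspose]
  have hoo : IsStarProjection (Matrix.single o o (1 : ℂ)) :=
    ⟨by simp [IsIdempotentElem], hstar o o⟩
  obtain ⟨e, W, hWW, hW⟩ := exists_isometry_of_isStarProjection _ (isStarProjection_map φ hoo)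
  -- The range of `φ(e_oo)`, parametrised by `W`, is the multiplicity space; `φ(e_ao)` carries it to
  -- the `a`-th block.
  let V : Matrix m (k × Fin e) ℂ := Matrix.of fun x ab => (φ (Matrix.single ab.1 o 1) * W) x ab.2
  have hVmul : ∀ (M : Matrix k k ℂ) (c : Matrix (Fin e) (Fin e) ℂ), V * (M ⊗ₖ c) * Vᴴ =
      ∑ a, ∑ a', M a a' • (φ (Matrix.single a o 1) * (W * c * Wᴴ) * φ (Matrix.single o a' 1)) := by
    intro M c
    have hs : ∀ a', φ (Matrix.single o a' 1) = (φ (Matrix.single a' o 1))ᴴ := by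
      intro a'
      rw [← hstar a' o, map_star]
      rfl
    have : ∀ a a', φ (Matrix.single a o 1) * (W * c * Wᴴ) * φ (Matrix.single o a' 1) =
        (φ (Matrix.single a o 1) * W) * c * (φ (Matrix.single a' o 1) * W)ᴴ := by
      intro a a'
      rw [Matrix.conjTranspose_mul, hs a']
      simp only [Matrix.mul_assoc]
    simp only [this]
    exact columnBlocks_mul_kronecker (fun a => φ (Matrix.single a o 1) * W) M c
  -- Conjugation fixes the matrix units, so `φ` and `φ` after conjugation agree on them and one `V`
  -- serves both.
  have key : ∀ ψ : Matrix k k ℂ →⋆ₙₐ[ℝ] Matrix m m ℂ,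
      (∀ a b, ψ (Matrix.single a b 1) = φ (Matrix.single a b 1)) →
      IsStarProjection (Wᴴ * linPart ψ (Matrix.single o o 1) * W) ∧
      ∀ M, linPart ψ M = V * (M ⊗ₖ (Wᴴ * linPart ψ (Matrix.single o o 1) * W)) * Vᴴ := by
    intro ψ hψ
    have hl := isStarProjection_map (linPart ψ) hoo
    have hl1 : (W * Wᴴ) * linPart ψ (Matrix.single o o 1) = linPart ψ (Matrix.single o o 1) := by
      rw [hW, ← hψ, map_mul_linPart]
      simp
    have hl2 : linPart ψ (Matrix.single o o 1) * (W * Wᴴ) = linPart ψ (Matrix.single o o 1) := by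
      rw [hW, ← hψ, linPart_mul_map]
      simp
    refine ⟨⟨?_, ?_⟩, fun M => ?_⟩
    · rw [IsIdempotentElem]
      calc _ = Wᴴ * (linPart ψ (Matrix.single o o 1) * (W * Wᴴ)
              * linPart ψ (Matrix.single o o 1)) * W := by simp only [Matrix.mul_assoc]
        _ = _ := by rw [hl2, hl.isIdempotentElem.eq]
    · have hs : (linPart ψ (Matrix.single o o 1))ᴴ = linPart ψ (Matrix.single o o 1) :=
        hl.isSelfAdjoint
      rw [IsSelfAdjoint, Matrix.star_eq_conjTranspose]
      simp only [Matrix.conjTranspose_mul, Matrix.conjTranspose_conjTranspose, hs, Matrix.mul_assoc]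
    · have hmid : W * (Wᴴ * linPart ψ (Matrix.single o o 1) * W) * Wᴴ =
          linPart ψ (Matrix.single o o 1) := by
        calc _ = (W * Wᴴ) * (linPart ψ (Matrix.single o o 1) * (W * Wᴴ)) := by
              simp only [Matrix.mul_assoc]
          _ = _ := by rw [hl2, hl1]
      rw [hVmul, hmid]
      conv_lhs => rw [Matrix.matrix_eq_sum_single M]
      rw [map_sum]
      refine Finset.sum_congr rfl fun a _ => ?_
      rw [map_sum]
      refine Finset.sum_congr rfl fun a' _ => ?_
      -- `e_aa' = e_ao e_oo e_oa'`, and `linPart ψ` absorbs values of `ψ` on either side.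
      rw [← hψ, ← hψ, map_mul_linPart, linPart_mul_map, ← map_smul]
      simp
  obtain ⟨hp, hP⟩ := key φ fun _ _ => rfl
  obtain ⟨hq, hQ⟩ := key (φ.comp (conjHom k)) fun a b => by
    rw [NonUnitalStarAlgHom.comp_apply, hconj]
  refine ⟨e, V, _, _, ?_, hp, hq, ?_, hP, hQ⟩
  · ext ⟨a, b⟩ ⟨a', b'⟩
    -- The blocks are orthonormal because `φ(e_oa) φ(e_a'o) = δ_aa' φ(e_oo) = δ_aa' W W†`.
    have h : (φ (Matrix.single a o 1) * W)ᴴ * (φ (Matrix.single a' o 1) * W) =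
        if a = a' then 1 else 0 := by
      rw [Matrix.conjTranspose_mul, ← Matrix.star_eq_conjTranspose (φ _), ← map_star, hstar,
        Matrix.mul_assoc, ← Matrix.mul_assoc (φ _), ← map_mul]
      split_ifs with haa
      · subst haa
        rw [Matrix.single_mul_single_same, mul_one, ← hW]
        rw [Matrix.mul_assoc W, hWW, Matrix.mul_one, hWW]
      · simp [haa]
    have h2 : (Vᴴ * V) (a, b) (a', b') =
        ((φ (Matrix.single a o 1) * W)ᴴ * (φ (Matrix.single a' o 1) * W)) b b' := rfl
    rw [h2, h]
    split_ifs with haa <;> simp [Matrix.one_apply, haa]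
  · have hl2 : linPart φ (Matrix.single o o 1) * (W * Wᴴ) = linPart φ (Matrix.single o o 1) := by
      rw [hW, linPart_mul_map]
      simp
    calc _ = Wᴴ * (linPart φ (Matrix.single o o 1) * (W * Wᴴ)
              * linPart (φ.comp (conjHom k)) (Matrix.single o o 1)) * W := by
            simp only [Matrix.mul_assoc]
      _ = 0 := by rw [hl2, linPart_mul_linPart_conj, Matrix.mul_zero, Matrix.zero_mul]

end Isometry

end

/-! ### Support projections at a site -/

section Support

/-- The orthogonal projection onto the span of a family of vectors. -/
theorem exists_span_projection {m ι : Type*} [Fintype m] [DecidableEq m] (u : ι → m → ℂ) :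
    ∃ s : Matrix m m ℂ, IsStarProjection s ∧ (∀ i, s *ᵥ u i = u i) ∧
      ∀ X : Matrix m m ℂ, (∀ i, X *ᵥ u i = 0) → X * s = 0 := by
  let K : Submodule ℂ (EuclideanSpace ℂ m) :=
    Submodule.span ℂ (Set.range fun i => WithLp.toLp 2 (u i))
  let T := (Matrix.toEuclideanCLM (n := m) (𝕜 := ℂ)).symm
  have hT : ∀ v, T K.starProjection *ᵥ v = (K.starProjection (WithLp.toLp 2 v)).ofLp := by
    intro v
    rw [← Matrix.ofLp_toEuclideanCLM, StarAlgEquiv.apply_symm_apply]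
  have hK : IsStarProjection K.starProjection := isStarProjection_starProjection
  refine ⟨T K.starProjection, ⟨by rw [IsIdempotentElem, ← map_mul, hK.isIdempotentElem.eq],
    (T.map_star' _).symm.trans (congrArg T hK.isSelfAdjoint)⟩, fun i => ?_, fun X hX => ?_⟩
  · have hi : WithLp.toLp 2 (u i) ∈ K := Submodule.subset_span ⟨i, rfl⟩
    rw [hT, Submodule.starProjection_eq_self_iff.2 hi]
  · have hK : K ≤ LinearMap.ker (Matrix.toEuclideanLin X) := by
      refine Submodule.span_le.2 ?_
      rintro _ ⟨i, rfl⟩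
      simp [hX i, Matrix.toLpLin_apply]
    refine Matrix.ext_of_mulVec_single fun j => ?_
    rw [← Matrix.mulVec_mulVec, hT, Matrix.zero_mulVec]
    have := hK (K.starProjection_apply_mem (WithLp.toLp 2 (Pi.single j 1)))
    rw [LinearMap.mem_ker, Matrix.toLpLin_apply] at this
    exact congrArg WithLp.ofLp this

variable {n : ℕ} {d : Fin n → ℕ}

/-- The support projection of `R` at site `j`. -/
theorem exists_site_support (j : Fin n) (R : Matrix (Idx d) (Idx d) ℂ) :
    ∃ s : Matrix (Fin (d j)) (Fin (d j)) ℂ, IsStarProjection s ∧ onSite j s * R = R ∧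
      ∀ X, onSite j X * R = 0 → X * s = 0 := by
  -- The vectors are the slices of the columns of `R` along site `j`; `onSite j X * R = 0` says that
  -- `X` kills all of them.
  obtain ⟨s, hs, h1, h2⟩ := exists_span_projection
    fun (xz : Idx d × Idx d) (a : Fin (d j)) => R (Function.update xz.1 j a) xz.2
  refine ⟨s, hs, ?_, fun X hX => h2 X ?_⟩
  · ext x z
    rw [onSite_mul_apply]
    have := congrFun (h1 (x, z)) (x j)
    simpa [Matrix.mulVec, dotProduct] using this
  · rintro ⟨x, z⟩
    funext b
    have := congrFun (congrFun hX (Function.update x j b)) z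
    rw [onSite_mul_apply] at this
    simpa [Matrix.mulVec, dotProduct] using this

end Support

/-! ### Restriction of the encoding to a site -/

section Local

/-- Closure under complex scalars is not assumed. With two basis vectors available, arbitrary
complex off-diagonal entries come from Hermitian matrices, and diagonal ones from products of these.
In dimension one, only the real scalars would be reached. -/
theorem hermitian_induction {k : Type*} [Fintype k] [DecidableEq k] [Nontrivial k]
    {p : Matrix k k ℂ → Prop} (herm : ∀ A, A.IsHermitian → p A)
    (add : ∀ A B, p A → p B → p (A + B)) (mul : ∀ A B, p A → p B → p (A * B))
    (M : Matrix k k ℂ) : p M := by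
  have zero : p 0 := herm 0 Matrix.isHermitian_zero
  have off : ∀ (a b : k) (z : ℂ), a ≠ b → p (Matrix.single a b z) := by
    intro a b z hab
    -- Left multiplication by `e_aa` removes the lower half of the Hermitian matrix `z e_ab + z̄
    -- e_ba`.
    have h : Matrix.single a b z = Matrix.single a a 1 *
        (Matrix.single a b z + Matrix.single b a (star z)) := by
      rw [mul_add, Matrix.single_mul_single_same, Matrix.single_mul_single_of_ne _ _ _ _ hab]
      simp
    rw [h]
    refine mul _ _ (herm _ ?_) (herm _ ?_)
    · simp [Matrix.IsHermitian]
    · simp [Matrix.IsHermitian, add_comm]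
  rw [Matrix.matrix_eq_sum_single M]
  refine Finset.sum_induction _ p add zero fun a _ =>
    Finset.sum_induction _ p add zero fun b _ => ?_
  rcases ne_or_eq a b with hab | rfl
  · exact off a b _ hab
  · obtain ⟨b, hb⟩ := exists_ne a
    have h := mul _ _ (off a b (M a a) hb.symm) (off b a 1 hb)
    rwa [Matrix.single_mul_single_same, mul_one] at h

variable {n : ℕ} {d d' : Fin n → ℕ}

/-- A homomorphism which maps single-site Hermitian operators to local operators restricts, at
each site, to a homomorphism between the algebras of that site. -/
theorem exists_siteHom (E : Matrix (Idx d) (Idx d) ℂ →⋆ₙₐ[ℝ] Matrix (Idx d') (Idx d') ℂ)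
    (j : Fin n) (hj : 2 ≤ d j)
    (hE : ∀ A : Matrix (Fin (d j)) (Fin (d j)) ℂ, A.IsHermitian →
      ∃ A' : Matrix (Fin (d' j)) (Fin (d' j)) ℂ, A'.IsHermitian ∧
        E (onSite j A) = onSite j A' * E 1) :
    ∃ φ : Matrix (Fin (d j)) (Fin (d j)) ℂ →⋆ₙₐ[ℝ] Matrix (Fin (d' j)) (Fin (d' j)) ℂ,
      ∀ M, E (onSite j M) = onSite j (φ M) * E 1 := by
  have hR : (E 1)ᴴ = E 1 := by
    rw [← Matrix.star_eq_conjTranspose, ← map_star, star_one]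
  have hER : ∀ M, E M * E 1 = E M := fun M => by rw [← map_mul, mul_one]
  have hRE : ∀ M, E 1 * E M = E M := fun M => by rw [← map_mul, one_mul]
  have hstar : ∀ M, E (onSite j Mᴴ) = (E (onSite j M))ᴴ := fun M => by
    rw [← onSite_conjTranspose, ← Matrix.star_eq_conjTranspose, map_star,
      Matrix.star_eq_conjTranspose]
  have : Nontrivial (Fin (d j)) := Fin.nontrivial_iff_two_le.2 hj
  -- The equation is carried on both sides of `E 1`, so that products can be formed from either
  -- side. For Hermitian `A` the second equation is the adjoint of the first.
  have hloc : ∀ M : Matrix (Fin (d j)) (Fin (d j)) ℂ, ∃ X : Matrix (Fin (d' j)) (Fin (d' j)) ℂ,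
      onSite j X * E 1 = E (onSite j M) ∧ E 1 * onSite j X = E (onSite j M) := by
    refine hermitian_induction ?_ ?_ ?_
    · intro A hA
      obtain ⟨X, hX, h⟩ := hE A hA
      refine ⟨X, h.symm, ?_⟩
      have := congrArg Matrix.conjTranspose h
      rw [← hstar, hA.eq, Matrix.conjTranspose_mul, hR, onSite_conjTranspose, hX.eq] at this
      exact this.symm
    · rintro A B ⟨X, hX, hX'⟩ ⟨Y, hY, hY'⟩
      refine ⟨X + Y, ?_, ?_⟩
      · rw [onSite_add, onSite_add, add_mul, hX, hY, map_add]
      · rw [onSite_add, onSite_add, mul_add, hX', hY', map_add]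
    · rintro A B ⟨X, hX, hX'⟩ ⟨Y, hY, hY'⟩
      refine ⟨X * Y, ?_, ?_⟩
      · rw [onSite_mul, onSite_mul, map_mul, Matrix.mul_assoc, hY, ← hRE (onSite j B),
          ← Matrix.mul_assoc, hX, hRE]
      · rw [onSite_mul, onSite_mul, map_mul, ← Matrix.mul_assoc, hX', ← hER (onSite j A),
          Matrix.mul_assoc, hY', hER]
  -- `X` is determined only up to site operators annihilating `E 1`. Replacing it by `s X s` makes
  -- it unique, and uniqueness turns every algebraic law of `E` into one for `φ`.
  obtain ⟨s, hs, hsR, huniq⟩ := exists_site_support j (E 1)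
  have hss : s * s = s := hs.isIdempotentElem
  have hsH : sᴴ = s := hs.isSelfAdjoint
  have hRs : E 1 * onSite j s = E 1 := by
    have := congrArg Matrix.conjTranspose hsR
    rwa [Matrix.conjTranspose_mul, onSite_conjTranspose, hsH, hR] at this
  have hex : ∀ M : Matrix (Fin (d j)) (Fin (d j)) ℂ, ∃ X : Matrix (Fin (d' j)) (Fin (d' j)) ℂ,
      onSite j X * E 1 = E (onSite j M) ∧ E 1 * onSite j X = E (onSite j M) ∧
        X * s = X ∧ s * X = X := by
    intro M
    obtain ⟨X, h1, h2⟩ := hloc M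
    refine ⟨s * X * s, ?_, ?_, ?_, ?_⟩
    · rw [onSite_mul, onSite_mul, Matrix.mul_assoc, hsR, Matrix.mul_assoc, h1, ← hRE,
        ← Matrix.mul_assoc, hsR]
    · rw [Matrix.mul_assoc, onSite_mul, ← Matrix.mul_assoc, hRs, onSite_mul, ← Matrix.mul_assoc,
        h2, ← hER, Matrix.mul_assoc, hRs]
    · rw [Matrix.mul_assoc, hss]
    · rw [← Matrix.mul_assoc, ← Matrix.mul_assoc, hss]
  choose φ h1 h2 h3 h4 using hex
  have uniq : ∀ X Y : Matrix (Fin (d' j)) (Fin (d' j)) ℂ, X * s = X → Y * s = Y →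
      onSite j X * E 1 = onSite j Y * E 1 → X = Y := by
    intro X Y hX hY h
    have := huniq (X - Y) (by rw [onSite_sub, sub_mul, h, sub_self])
    rwa [sub_mul, hX, hY, sub_eq_zero] at this
  have hsmul : ∀ (c : ℝ) M, φ (c • M) = c • φ M := by
    intro c M
    refine uniq _ _ (h3 _) (by rw [Matrix.smul_mul, h3]) ?_
    rw [h1, ← Complex.coe_smul c M, onSite_smul, Complex.coe_smul, map_smul,
      ← Complex.coe_smul c (φ M), onSite_smul, Matrix.smul_mul, h1, Complex.coe_smul]
  refine ⟨{ toFun := φ, map_smul' := hsmul, map_zero' := ?_, map_add' := ?_, map_mul' := ?_,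
            map_star' := ?_ }, fun M => (h1 M).symm⟩
  · simpa using hsmul 0 0
  · intro M N
    refine uniq _ _ (h3 _) (by rw [add_mul, h3, h3]) ?_
    rw [h1, onSite_add, onSite_add, add_mul, h1, h1, map_add]
  · intro M N
    refine uniq _ _ (h3 _) (by rw [Matrix.mul_assoc, h3]) ?_
    rw [h1, onSite_mul, onSite_mul, Matrix.mul_assoc, h1 N, ← hRE (onSite j N),
      ← Matrix.mul_assoc, h1 M, map_mul]
  · intro M
    change φ Mᴴ = (φ M)ᴴ
    refine uniq _ _ (h3 _) ?_ ?_
    · conv_rhs => rw [← h4 M, Matrix.conjTranspose_mul, hsH]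
    · rw [h1, hstar, ← onSite_conjTranspose, ← h2 M, Matrix.conjTranspose_mul, hR]

/-- `E 1` may be replaced by `linPart E 1` because `E M * linPart E 1 = linPart E M`. -/
theorem linPart_onSite (E : Matrix (Idx d) (Idx d) ℂ →⋆ₙₐ[ℝ] Matrix (Idx d') (Idx d') ℂ)
    (j : Fin n) (φ : Matrix (Fin (d j)) (Fin (d j)) ℂ →⋆ₙₐ[ℝ] Matrix (Fin (d' j)) (Fin (d' j)) ℂ)
    (h : ∀ M, E (onSite j M) = onSite j (φ M) * E 1) (M : Matrix (Fin (d j)) (Fin (d j)) ℂ) :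
    linPart E (onSite j M) = onSite j (linPart φ M) * linPart E 1 := by
  have h1 : linPart E (onSite j M) = onSite j (linPart φ M) * E 1 := by
    rw [linPart_apply, linPart_apply, ← onSite_smul, h, h, onSite_smul, onSite_sub, onSite_smul]
    simp only [Matrix.smul_mul, sub_mul]
  rw [← mul_one (onSite j M), map_mul, h1, Matrix.mul_assoc, map_mul_linPart, mul_one]

end Local

/-! ### Gluing the site representations -/

section Global

variable {n : ℕ} {d e d' : Fin n → ℕ}

/-- If a complex-linear homomorphism is at each site `j` a multiple of the identity
representation, twisted by the isometry `V j`, then so it is globally. -/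
theorem exists_multiplicity_projection [Nonempty (Idx d)]
    (V : (j : Fin n) → Matrix (Fin (d' j)) (Fin (d j) × Fin (e j)) ℂ)
    (hV : ∀ j, (V j)ᴴ * V j = 1)
    (p : (j : Fin n) → Matrix (Fin (e j)) (Fin (e j)) ℂ)
    (F : Matrix (Idx d) (Idx d) ℂ →⋆ₙₐ[ℂ] Matrix (Idx d') (Idx d') ℂ)
    (hF : ∀ j (M : Matrix (Fin (d j)) (Fin (d j)) ℂ),
      F (onSite j M) = onSite j (V j * (M ⊗ₖ p j) * (V j)ᴴ) * F 1) :
    ∃ P : Matrix (Idx e) (Idx e) ℂ, IsStarProjection P ∧ (∀ j, onSite j (p j) * P = P) ∧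
      ∀ M, F M = tensorPaired V * (M ⊗ₖ P) * (tensorPaired V)ᴴ := by
  set T := tensorPaired V with hT
  have hTT : Tᴴ * T = 1 := tensorPaired_conjTranspose_mul_self V hV
  have hint : ∀ j (M : Matrix (Fin (d j)) (Fin (d j)) ℂ), onSite j (V j * (M ⊗ₖ p j) * (V j)ᴴ) * T =
      T * (onSite j M ⊗ₖ onSite j (p j)) := fun j M =>
    onSite_mul_tensorPaired_of_intertwine j V _ _ _ (by rw [Matrix.mul_assoc, hV, Matrix.mul_one])
  -- `F 1` is supported in the range of `T`: at every site it is fixed by `V j (V j)†`, and the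
  -- product of these is `T T†`.
  have hsup : T * Tᴴ * F 1 = F 1 := by
    rw [hT, tensorPaired_mul_conjTranspose]
    refine tensor_mul_eq_self _ _ fun j => ?_
    have h1 := hF j 1
    rw [onSite_one] at h1
    rw [h1, ← Matrix.mul_assoc, ← onSite_mul]
    congr 2
    calc _ = V j * ((V j)ᴴ * V j) * ((1 : Matrix (Fin (d j)) (Fin (d j)) ℂ) ⊗ₖ p j) * (V j)ᴴ := by
          simp only [Matrix.mul_assoc]
      _ = _ := by rw [hV, Matrix.mul_one]
  have hsupF : ∀ M, T * Tᴴ * F M = F M := fun M => by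
    rw [← one_mul M, map_mul, ← Matrix.mul_assoc, hsup]
  have hFsup : ∀ M, F M * (T * Tᴴ) = F M := fun M => by
    have := congrArg Matrix.conjTranspose (hsupF Mᴴ)
    rw [Matrix.conjTranspose_mul, ← Matrix.star_eq_conjTranspose M, map_star,
      Matrix.star_eq_conjTranspose, Matrix.conjTranspose_conjTranspose, Matrix.conjTranspose_mul,
      Matrix.conjTranspose_conjTranspose] at this
    exact this
  have hGmul : ∀ M N, Tᴴ * F (M * N) * T = (Tᴴ * F M * T) * (Tᴴ * F N * T) := fun M N => by
    calc _ = Tᴴ * (F M * (T * Tᴴ * F N)) * T := by rw [hsupF, ← map_mul]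
      _ = _ := by simp only [Matrix.mul_assoc]
  set R := Tᴴ * F 1 * T with hR
  have hsite : ∀ j (M : Matrix (Fin (d j)) (Fin (d j)) ℂ),
      Tᴴ * F (onSite j M) * T = (onSite j M ⊗ₖ onSite j (p j)) * R := fun j M => by
    calc _ = Tᴴ * (onSite j (V j * (M ⊗ₖ p j) * (V j)ᴴ) * T) * Tᴴ * F 1 * T := by
          rw [hF]
          conv_lhs => rw [← hsup]
          simp only [Matrix.mul_assoc]
      _ = (Tᴴ * T) * (onSite j M ⊗ₖ onSite j (p j)) * R := by
          rw [hint]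
          simp only [Matrix.mul_assoc, hR]
      _ = _ := by rw [hTT, Matrix.one_mul]
  have hpR : ∀ j, (1 ⊗ₖ onSite j (p j)) * R = R := fun j => by
    have := hsite j 1
    rw [onSite_one] at this
    exact this.symm
  have hG : ∀ M, Tᴴ * F M * T = (M ⊗ₖ 1) * R := by
    refine matrix_induction_onSite ?_ ?_ ?_ ?_ ?_
    · rw [Matrix.one_kronecker_one, Matrix.one_mul]
    · intro A B hA hB
      rw [map_add, Matrix.mul_add, Matrix.add_mul, hA, hB, Matrix.add_kronecker, Matrix.add_mul]
    · intro c A hA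
      rw [map_smul, Matrix.mul_smul, Matrix.smul_mul, hA, Matrix.smul_kronecker, Matrix.smul_mul]
    · intro A B hA hB
      have hAB : (A * B) ⊗ₖ (1 : Matrix (Idx e) (Idx e) ℂ) = (A ⊗ₖ 1) * (B ⊗ₖ 1) := by
        rw [← Matrix.mul_kronecker_mul, Matrix.mul_one]
      rw [hGmul, hA, hAB, Matrix.mul_assoc _ _ R, ← hB, Matrix.mul_assoc _ R, hR, ← hGmul, one_mul]
    · intro j A
      rw [hsite]
      conv_rhs => rw [← hpR j, ← Matrix.mul_assoc, ← Matrix.mul_kronecker_mul, Matrix.mul_one,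
        Matrix.one_mul]
  have hRH : Rᴴ = R := by
    have h1 : (F 1)ᴴ = F 1 := by rw [← Matrix.star_eq_conjTranspose, ← map_star, star_one]
    rw [hR]
    simp only [Matrix.conjTranspose_mul, Matrix.conjTranspose_conjTranspose, h1, Matrix.mul_assoc]
  -- The adjoint of `hG` at `M†` puts `R` on the other side of `M ⊗ 1`.
  have hcomm : ∀ M, (M ⊗ₖ (1 : Matrix (Idx e) (Idx e) ℂ)) * R = R * (M ⊗ₖ 1) := fun M => by
    have h1 := congrArg Matrix.conjTranspose (hG Mᴴ)
    rw [Matrix.conjTranspose_mul _ R, hRH, Matrix.conjTranspose_kronecker,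
      Matrix.conjTranspose_conjTranspose, Matrix.conjTranspose_one] at h1
    rw [← h1, ← hG, ← Matrix.star_eq_conjTranspose M, map_star, Matrix.star_eq_conjTranspose]
    simp only [Matrix.conjTranspose_mul, Matrix.conjTranspose_conjTranspose, Matrix.mul_assoc]
  obtain ⟨P, hP⟩ := exists_eq_one_kronecker_of_commute R hcomm
  have hinj := one_kronecker_injective (k := Idx d) (l := Idx e)
  refine ⟨P, ⟨hinj ?_, hinj ?_⟩, fun j => hinj ?_, fun M => ?_⟩
  · change (1 : Matrix (Idx d) (Idx d) ℂ) ⊗ₖ (P * P) = 1 ⊗ₖ P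
    conv_lhs => rw [← Matrix.mul_one (1 : Matrix (Idx d) (Idx d) ℂ), Matrix.mul_kronecker_mul]
    rw [← hP, hR, ← hGmul, mul_one]
  · change (1 : Matrix (Idx d) (Idx d) ℂ) ⊗ₖ Pᴴ = 1 ⊗ₖ P
    conv_lhs => rw [← Matrix.conjTranspose_one, ← Matrix.conjTranspose_kronecker]
    rw [← hP, hRH]
  · change (1 : Matrix (Idx d) (Idx d) ℂ) ⊗ₖ (onSite j (p j) * P) = 1 ⊗ₖ P
    conv_lhs => rw [← Matrix.mul_one (1 : Matrix (Idx d) (Idx d) ℂ), Matrix.mul_kronecker_mul]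
    rw [← hP, hpR]
  · have h1 : M ⊗ₖ P = (M ⊗ₖ 1) * R := by
      rw [hP, ← Matrix.mul_kronecker_mul, Matrix.mul_one, Matrix.one_mul]
    rw [h1, ← hG]
    calc _ = T * Tᴴ * (F M * (T * Tᴴ)) := by rw [hFsup, hsupF]
      _ = _ := by simp only [Matrix.mul_assoc]

end Global

/-! ### Operators supported on a subspace -/

section Restriction

variable {m : Type*} [Fintype m] [DecidableEq m] {S : Submodule ℂ (EuclideanSpace ℂ m)}
  {X Y : Matrix m m ℂ}

theorem coe_restrictTo (hX : ∀ v, Matrix.toEuclideanLin X v ∈ S) (v : S) :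
    (restrictTo S X v : EuclideanSpace ℂ m) = Matrix.toEuclideanLin X v :=
  congrArg Subtype.val
    (Submodule.orthogonalProjectionOnto_mem_subspace_eq_self (⟨_, hX v⟩ : S))

theorem restrictTo_add (X Y : Matrix m m ℂ) :
    restrictTo S (X + Y) = restrictTo S X + restrictTo S Y := by
  ext v
  simp [restrictTo]

theorem restrictTo_smul (c : ℂ) (X : Matrix m m ℂ) :
    restrictTo S (c • X) = c • restrictTo S X := by
  ext v
  simp [restrictTo]

theorem restrictTo_mul (hX : ∀ v, Matrix.toEuclideanLin X v ∈ S)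
    (hY : ∀ v, Matrix.toEuclideanLin Y v ∈ S) :
    restrictTo S (X * Y) = restrictTo S X * restrictTo S Y := by
  ext1 v
  apply Subtype.ext
  rw [Module.End.mul_apply, coe_restrictTo hX, coe_restrictTo hY, coe_restrictTo]
  · rw [Matrix.toLpLin_mul_same, LinearMap.comp_apply]
  · intro v
    rw [Matrix.toLpLin_mul_same, LinearMap.comp_apply]
    exact hX _

theorem inner_toEuclideanLin (X : Matrix m m ℂ) (u v : EuclideanSpace ℂ m) :
    inner ℂ (Matrix.toEuclideanLin Xᴴ u) v = inner ℂ u (Matrix.toEuclideanLin X v) := by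
  rw [Matrix.toEuclideanLin_conjTranspose_eq_adjoint, LinearMap.adjoint_inner_left]

/-- Compression to `S` commutes with the adjoint, so no support condition is needed. -/
theorem restrictTo_conjTranspose (X : Matrix m m ℂ) :
    restrictTo S Xᴴ = LinearMap.adjoint (𝕜 := ℂ) (E := S) (F := S) (restrictTo S X) := by
  refine (LinearMap.eq_adjoint_iff (𝕜 := ℂ) (E := S) (F := S) _ _).2 fun u v => ?_
  simp only [restrictTo, LinearMap.comp_apply, ContinuousLinearMap.coe_coe,
    Submodule.subtype_apply]
  rw [Submodule.inner_orthogonalProjectionOnto_eq_of_mem_right,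
    Submodule.inner_orthogonalProjectionOnto_eq_of_mem_left, inner_toEuclideanLin]

/-- Taking adjoints exchanges the two support conditions. -/
theorem SupportedOn.conjTranspose (hX : SupportedOn S X) : SupportedOn S Xᴴ := by
  refine ⟨fun v => ?_, fun v hv => ?_⟩
  · rw [← Submodule.orthogonal_orthogonal S, Submodule.mem_orthogonal']
    intro u hu
    rw [inner_toEuclideanLin, hX.2 u hu, inner_zero_right]
  · refine ext_inner_right ℂ fun u => ?_
    rw [inner_toEuclideanLin, inner_zero_left]
    exact (Submodule.mem_orthogonal' S v).1 hv _ (hX.1 u)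

theorem SupportedOn.mul (hX : SupportedOn S X) (hY : SupportedOn S Y) :
    SupportedOn S (X * Y) := by
  simp only [SupportedOn, Matrix.toLpLin_mul_same, LinearMap.comp_apply]
  exact ⟨fun v => hX.1 _, fun v hv => by rw [hY.2 v hv, map_zero]⟩

theorem SupportedOn.add (hX : SupportedOn S X) (hY : SupportedOn S Y) :
    SupportedOn S (X + Y) := by
  simp only [SupportedOn, map_add, LinearMap.add_apply]
  exact ⟨fun v => S.add_mem (hX.1 v) (hY.1 v), fun v hv => by rw [hX.2 v hv, hY.2 v hv, add_zero]⟩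

theorem SupportedOn.smul (c : ℂ) (hX : SupportedOn S X) : SupportedOn S (c • X) := by
  simp only [SupportedOn, map_smul, LinearMap.smul_apply]
  exact ⟨fun v => S.smul_mem c (hX.1 v), fun v hv => by rw [hX.2 v hv, smul_zero]⟩

/-- Both operators vanish on `Sᗮ`. This lifts the encoding laws from `S` to the ambient matrices. -/
theorem SupportedOn.ext (hX : SupportedOn S X) (hY : SupportedOn S Y)
    (h : restrictTo S X = restrictTo S Y) : X = Y := by
  refine Matrix.toEuclideanLin.injective (LinearMap.ext fun v => ?_)
  obtain ⟨y, hy, z, hz, rfl⟩ := S.exists_add_mem_mem_orthogonal v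
  rw [map_add, map_add, hX.2 z hz, hY.2 z hz, ← coe_restrictTo hX.1 ⟨y, hy⟩,
    ← coe_restrictTo hY.1 ⟨y, hy⟩, h]

end Restriction

/-! ### Subspace encodings as real star-homomorphisms -/

section Encoding

variable {k m : Type*} [Fintype k] [DecidableEq k] [Fintype m] [DecidableEq m]

/-- A subspace encoding is a nonzero homomorphism of real star-algebras. -/
theorem IsSubspaceEncoding.exists_starHom [Nonempty k] {E : Matrix k k ℂ → Matrix m m ℂ}
    (hE : IsSubspaceEncoding E) :
    ∃ φ : Matrix k k ℂ →⋆ₙₐ[ℝ] Matrix m m ℂ, (∀ M, φ M = E M) ∧ φ 1 ≠ 0 := by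
  obtain ⟨S, hS, h⟩ := hE
  have hsmul : ∀ (x : ℝ) M, E (x • M) = x • E M := by
    intro x M
    rw [← Complex.coe_smul, ← Complex.coe_smul]
    refine (hS _).ext ((hS _).smul _) ?_
    rw [restrictTo_smul]
    exact h.map_real_smul x M
  refine ⟨{ toFun := E, map_smul' := hsmul, map_zero' := ?_, map_add' := ?_, map_mul' := ?_,
            map_star' := ?_ }, fun _ => rfl, fun h1 => ?_⟩
  · simpa using hsmul 0 0
  · intro A B
    refine (hS _).ext ((hS _).add (hS _)) ?_
    rw [restrictTo_add]
    exact h.map_add A B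
  · intro A B
    refine (hS _).ext ((hS _).mul (hS _)) ?_
    rw [restrictTo_mul (hS _).1 (hS _).1]
    exact h.map_mul A B
  · intro A
    refine (hS _).ext (hS _).conjTranspose ?_
    exact (h.map_conjTranspose A).trans (restrictTo_conjTranspose (E A)).symm
  · have h2 : restrictTo S (E 1) = 0 := by
      rw [show E 1 = 0 from h1]
      ext v
      simp [restrictTo]
    -- If `E 1 = 0`, then `S` is trivial and the spectrum there is empty, whereas the identity on
    -- `ℂ^k` has spectrum `{1}`.
    have h3 := h.spectrum_eq 1 Matrix.isHermitian_one
    rw [spectrum.one_eq] at h3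
    have h4 : Subsingleton (S →ₗ[ℂ] S) :=
      subsingleton_of_zero_eq_one (h2.symm.trans h.map_one)
    rw [spectrum.of_subsingleton] at h3
    exact (Set.singleton_ne_empty _ h3.symm).elim

/-- Expresses singularity as a zero divisor, which an injective homomorphism transports. -/
theorem exists_mul_eq_zero_of_not_isUnit {A : Matrix k k ℂ} (hA : ¬ IsUnit A) :
    ∃ B : Matrix k k ℂ, B ≠ 0 ∧ A * B = 0 := by
  rw [Matrix.isUnit_iff_isUnit_det, isUnit_iff_ne_zero, not_not] at hA
  obtain ⟨v, hv, hAv⟩ := Matrix.exists_mulVec_eq_zero_iff.2 hA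
  refine ⟨Matrix.vecMulVec v v, ?_, ?_⟩
  · simpa [Matrix.vecMulVec_eq_zero] using hv
  · rw [Matrix.mul_vecMulVec, hAv, Matrix.zero_vecMulVec]

theorem im_eq_zero_of_mem_spectrum {K : Type*} [NormedAddCommGroup K] [InnerProductSpace ℂ K]
    [FiniteDimensional ℂ K] {T : K →ₗ[ℂ] K} (hT : T.IsSymmetric) {μ : ℂ}
    (hμ : μ ∈ spectrum ℂ T) : μ.im = 0 :=
  Complex.conj_eq_iff_im.1
    (hT.conj_eigenvalue_eq_self (Module.End.hasEigenvalue_iff_mem_spectrum.2 hμ))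

/-- Injectivity makes `ψ` preserve and reflect invertibility. Since `ψ` is only real-homogeneous,
this compares `x - A` with `x - ψ A` for real `x` only; that suffices, as Hermitian spectra are
real. -/
theorem isEncoding_of_injective {K : Type*} [NormedAddCommGroup K] [InnerProductSpace ℂ K]
    [FiniteDimensional ℂ K] {ψ : Matrix k k ℂ → (K →ₗ[ℂ] K)} (hone : ψ 1 = 1)
    (hadj : ∀ A, ψ Aᴴ = LinearMap.adjoint (ψ A)) (hadd : ∀ A B, ψ (A + B) = ψ A + ψ B)
    (hmul : ∀ A B, ψ (A * B) = ψ A * ψ B)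
    (hsmul : ∀ (x : ℝ) A, ψ ((x : ℂ) • A) = (x : ℂ) • ψ A) (hinj : Function.Injective ψ) :
    IsEncoding ψ := by
  have hsa : ∀ A, A.IsHermitian → IsSelfAdjoint (ψ A) := by
    intro A hA
    rw [IsSelfAdjoint, LinearMap.star_eq_adjoint, ← hadj, hA.eq]
  have hunit : ∀ A, IsUnit (ψ A) ↔ IsUnit A := by
    intro A
    refine ⟨fun hA => ?_, fun ⟨u, hu⟩ => ?_⟩
    · by_contra hn
      obtain ⟨B, hB, hAB⟩ := exists_mul_eq_zero_of_not_isUnit hn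
      have h0 : ψ 0 = 0 := by simpa using hsmul 0 0
      have h1 : ψ A * ψ B = 0 := by rw [← hmul, hAB, h0]
      rw [hA.mul_right_eq_zero, ← h0] at h1
      exact hB (hinj h1)
    · refine ⟨⟨ψ A, ψ ↑u⁻¹, ?_, ?_⟩, rfl⟩
      · rw [← hmul, ← hu, Units.mul_inv, hone]
      · rw [← hmul, ← hu, Units.inv_mul, hone]
  refine ⟨hsa, fun A hA => ?_, fun A B _ _ p _ _ => ?_, hone, hadj, hadd, hmul, hsmul⟩
  · have hreal : ∀ x : ℝ, (x : ℂ) ∈ spectrum ℂ (ψ A) ↔ (x : ℂ) ∈ spectrum ℂ A := by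
      intro x
      have hneg : ψ (-A) = -ψ A := by simpa using hsmul (-1) A
      rw [spectrum.mem_iff, spectrum.mem_iff, ← hunit, Algebra.algebraMap_eq_smul_one,
        Algebra.algebraMap_eq_smul_one, sub_eq_add_neg, sub_eq_add_neg, hadd, hsmul, hone, hneg]
    ext μ
    constructor
    · intro hμ
      have h0 := im_eq_zero_of_mem_spectrum
        ((LinearMap.isSymmetric_iff_isSelfAdjoint _).2 (hsa A hA)) hμ
      rw [show μ = (μ.re : ℂ) from Complex.ext rfl h0] at hμ ⊢
      exact (hreal _).1 hμ
    · intro hμ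
      have h0 := im_eq_zero_of_mem_spectrum (Matrix.isSymmetric_toEuclideanLin_iff.2 hA)
        (by rwa [Matrix.spectrum_toLpLin])
      rw [show μ = (μ.re : ℂ) from Complex.ext rfl h0] at hμ ⊢
      exact (hreal _).2 hμ
  · have := hsmul (1 - p) B
    push_cast at this
    rw [hadd, hsmul, this]

/-- An injective homomorphism of real star-algebras is a subspace encoding. -/
theorem isSubspaceEncoding_of_injective (φ : Matrix k k ℂ →⋆ₙₐ[ℝ] Matrix m m ℂ)
    (hφ : Function.Injective φ) : IsSubspaceEncoding φ := by
  -- `φ 1` is a projection and a two-sided unit for the image, so its range is the encoding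
  -- subspace.
  let S := LinearMap.range (Matrix.toEuclideanLin (φ 1))
  have hφ1 : ∀ v ∈ S, Matrix.toEuclideanLin (φ 1) v = v := by
    rintro _ ⟨v, rfl⟩
    rw [← LinearMap.comp_apply, ← Matrix.toLpLin_mul_same, ← map_mul, mul_one]
  have hstar : ∀ M, φ Mᴴ = (φ M)ᴴ := fun M => map_star φ M
  have hS : ∀ M, SupportedOn S (φ M) := by
    intro M
    refine ⟨fun v => ⟨Matrix.toEuclideanLin (φ M) v, ?_⟩, fun v hv => ?_⟩
    · rw [← LinearMap.comp_apply, ← Matrix.toLpLin_mul_same, ← map_mul, one_mul]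
    · refine ext_inner_left ℂ fun u => ?_
      rw [← inner_toEuclideanLin, inner_zero_right]
      refine (Submodule.mem_orthogonal S v).1 hv _ ⟨Matrix.toEuclideanLin (φ M)ᴴ u, ?_⟩
      rw [← LinearMap.comp_apply, ← Matrix.toLpLin_mul_same, ← hstar, ← map_mul, one_mul]
  refine ⟨S, hS, isEncoding_of_injective ?_ (fun A => ?_) (fun A B => ?_) (fun A B => ?_)
    (fun x A => ?_) fun A B h => hφ ((hS A).ext (hS B) h)⟩
  · ext1 v
    apply Subtype.ext
    rw [coe_restrictTo (hS 1).1, hφ1 v v.2]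
    rfl
  · simp only [hstar]
    exact restrictTo_conjTranspose (φ A)
  · simp only [map_add]
    exact restrictTo_add _ _
  · simp only [map_mul]
    exact restrictTo_mul (hS _).1 (hS _).1
  · simp only [Complex.coe_smul, map_smul]
    simp only [← Complex.coe_smul]
    exact restrictTo_smul _ _

end Encoding

/-! ### From a local encoding to the normal form -/

variable {n : ℕ} {d d' : Fin n → ℕ}

theorem IsLocalSubspaceEncoding.exists_form (hd : ∀ j, 2 ≤ d j)
    {E : Matrix (Idx d) (Idx d) ℂ → Matrix (Idx d') (Idx d') ℂ}
    (hE : IsLocalSubspaceEncoding E) :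
    ∃ (e : Fin n → ℕ)
      (V : (j : Fin n) → Matrix (Fin (d' j)) (Fin (d j) × Fin (e j)) ℂ)
      (P Q : Matrix (Idx e) (Idx e) ℂ),
      (∀ j, (V j)ᴴ * V j = 1) ∧
      IsStarProjection P ∧ IsStarProjection Q ∧ P * Q = 0 ∧
      LocallyDistinguishable P Q ∧
      ¬ (P = 0 ∧ Q = 0) ∧
      ∀ M, E M = tensorPaired V * (M ⊗ₖ P + M.map star ⊗ₖ Q) * (tensorPaired V)ᴴ := by
  have hne : ∀ j, Nonempty (Fin (d j)) := fun j => ⟨⟨0, by have := hd j; omega⟩⟩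
  have : Nonempty (Idx d) := ⟨fun j => (hne j).some⟩
  obtain ⟨hsub, hloc⟩ := hE
  obtain ⟨F, hF, hF1⟩ := hsub.exists_starHom
  obtain rfl : ⇑F = E := funext hF
  have hφ := fun j => exists_siteHom F j (hd j) (hloc j)
  choose φ hφ using hφ
  have hV := fun j => exists_isometry_linPart (φ j)
  choose e V p q hV hp hq hpq hVp hVq using hV
  obtain ⟨P, hP, hpP, hFP⟩ := exists_multiplicity_projection V hV p (linPart F) fun j M => by
    rw [← hVp, linPart_onSite F j (φ j) (hφ j)]
  -- Conjugation acts site by site, so `F` after conjugation is local with site homomorphisms `φ j`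
  -- after conjugation. Hence the same `V` applies, with `q` in place of `p`.
  have hφ' : ∀ j M, F.comp (conjHom _) (onSite j M) =
      onSite j ((φ j).comp (conjHom _) M) * F.comp (conjHom _) 1 := by
    intro j M
    have h1 : conjHom (Idx d) 1 = 1 := by
      rw [conjHom_apply, Matrix.map_one _ (star_zero _) (star_one _)]
    simp only [NonUnitalStarAlgHom.comp_apply, h1]
    rw [conjHom_apply, ← onSite_map_star, hφ]
    rfl
  obtain ⟨Q, hQ, hqQ, hFQ⟩ := exists_multiplicity_projection V hV q
    (linPart (F.comp (conjHom _))) fun j M => by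
      rw [← hVq, linPart_onSite _ j ((φ j).comp (conjHom _)) (hφ' j)]
  have hform : ∀ M, F M = tensorPaired V * (M ⊗ₖ P + M.map star ⊗ₖ Q) * (tensorPaired V)ᴴ := by
    intro M
    rw [Matrix.mul_add, Matrix.add_mul, ← hFP, ← hFQ, linPart_add_linPart_conj]
  refine ⟨e, V, P, Q, hV, hP, hQ, ?_, fun j => ⟨p j, q j, hp j, hq j, hpq j, hpP j, hqQ j⟩, ?_,
    hform⟩
  · have hTT := tensorPaired_conjTranspose_mul_self V hV
    -- Orthogonality of the two parts at the identity, pulled back along the isometry, gives `1 ⊗ PQ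
    -- = 0`.
    have h0 := linPart_mul_linPart_conj F 1 1
    rw [hFP, hFQ] at h0
    refine one_kronecker_injective (k := Idx d) ?_
    change (1 : Matrix (Idx d) (Idx d) ℂ) ⊗ₖ (P * Q) = 1 ⊗ₖ 0
    rw [Matrix.kronecker_zero]
    conv_lhs => rw [← Matrix.mul_one (1 : Matrix (Idx d) (Idx d) ℂ), Matrix.mul_kronecker_mul]
    generalize (1 : Matrix (Idx d) (Idx d) ℂ) ⊗ₖ P = A at h0 ⊢
    generalize (1 : Matrix (Idx d) (Idx d) ℂ) ⊗ₖ Q = B at h0 ⊢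
    generalize tensorPaired V = T at h0 hTT
    calc A * B = (Tᴴ * T) * A * (Tᴴ * T) * B * (Tᴴ * T) := by simp [hTT]
      _ = Tᴴ * (T * A * Tᴴ * (T * B * Tᴴ)) * T := by simp only [Matrix.mul_assoc]
      _ = 0 := by rw [h0, Matrix.mul_zero, Matrix.zero_mul]
  · rintro ⟨rfl, rfl⟩
    exact hF1 (by rw [hform]; simp)

/-! ### From the normal form to a local encoding -/

section Converse

variable {e : Fin n → ℕ}

theorem conjTranspose_map_star {k : Type*} (M : Matrix k k ℂ) :
    (M.map star)ᴴ = Mᴴ.map star := rfl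

/-- The homomorphism `M ↦ T (M ⊗ P + M̄ ⊗ Q) Tᴴ` given by an isometry and orthogonal projections. -/
def encodingHom {k l m : Type*} [Fintype k] [DecidableEq k] [Fintype l] [DecidableEq l] [Fintype m]
    (T : Matrix m (k × l) ℂ) (hT : Tᴴ * T = 1) (P Q : Matrix l l ℂ) (hP : IsStarProjection P)
    (hQ : IsStarProjection Q) (hPQ : P * Q = 0) : Matrix k k ℂ →⋆ₙₐ[ℝ] Matrix m m ℂ where
  toFun M := T * (M ⊗ₖ P + M.map star ⊗ₖ Q) * Tᴴ
  map_zero' := by simp [Matrix.map_zero]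
  map_add' M N := by
    rw [Matrix.map_add _ star_add, Matrix.add_kronecker, Matrix.add_kronecker, ← Matrix.add_mul,
      ← Matrix.mul_add]
    congr 2
    abel
  map_smul' c M := by
    have h : (c • M).map star = c • M.map star := map_smul (conjHom k) c M
    rw [h, Matrix.smul_kronecker, Matrix.smul_kronecker, ← smul_add, Matrix.mul_smul,
      Matrix.smul_mul]
    rfl
  map_mul' M N := by
    have hQP : Q * P = 0 := by
      have := congrArg star hPQ
      rwa [star_mul, hP.isSelfAdjoint.star_eq, hQ.isSelfAdjoint.star_eq, star_zero] at this
    have h : (M * N).map star = M.map star * N.map star := map_mul (conjHom k) M N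
    have h2 : (M ⊗ₖ P + M.map star ⊗ₖ Q) * (N ⊗ₖ P + N.map star ⊗ₖ Q) =
        (M * N) ⊗ₖ P + (M * N).map star ⊗ₖ Q := by
      simp only [Matrix.mul_add, Matrix.add_mul, ← Matrix.mul_kronecker_mul, hPQ, hQP, h,
        Matrix.kronecker_zero, add_zero, zero_add, hP.isIdempotentElem.eq, hQ.isIdempotentElem.eq]
    rw [← h2]
    generalize M ⊗ₖ P + M.map star ⊗ₖ Q = A
    generalize N ⊗ₖ P + N.map star ⊗ₖ Q = B
    calc T * (A * B) * Tᴴ = T * (A * (Tᴴ * T) * B) * Tᴴ := by rw [hT, Matrix.mul_one]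
      _ = _ := by simp only [Matrix.mul_assoc]
  map_star' M := by
    have hP' : Pᴴ = P := hP.isSelfAdjoint
    have hQ' : Qᴴ = Q := hQ.isSelfAdjoint
    simp only [Matrix.star_eq_conjTranspose, Matrix.conjTranspose_mul, Matrix.conjTranspose_add,
      Matrix.conjTranspose_conjTranspose, Matrix.conjTranspose_kronecker, conjTranspose_map_star,
      hP', hQ', Matrix.mul_assoc]

theorem encodingHom_injective {k l m : Type*} [Fintype k] [DecidableEq k] [Fintype l]
    [DecidableEq l] [Fintype m] (T : Matrix m (k × l) ℂ) (hT : Tᴴ * T = 1) (P Q : Matrix l l ℂ)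
    (hP : IsStarProjection P) (hQ : IsStarProjection Q) (hPQ : P * Q = 0)
    (hne : ¬ (P = 0 ∧ Q = 0)) : Function.Injective (encodingHom T hT P Q hP hQ hPQ) := by
  rw [injective_iff_map_eq_zero]
  intro M hM
  change T * (M ⊗ₖ P + M.map star ⊗ₖ Q) * Tᴴ = 0 at hM
  have h0 : M ⊗ₖ P + M.map star ⊗ₖ Q = 0 := by
    generalize M ⊗ₖ P + M.map star ⊗ₖ Q = A at hM ⊢
    calc A = (Tᴴ * T) * A * (Tᴴ * T) := by rw [hT, Matrix.one_mul, Matrix.mul_one]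
      _ = Tᴴ * (T * A * Tᴴ) * T := by simp only [Matrix.mul_assoc]
      _ = 0 := by rw [hM, Matrix.mul_zero, Matrix.zero_mul]
  -- Right multiplication by `1 ⊗ P` isolates the linear branch.
  have hMP : M ⊗ₖ P = 0 := by
    have := congrArg (· * ((1 : Matrix k k ℂ) ⊗ₖ P)) h0
    have hQP : Q * P = 0 := by
      have := congrArg star hPQ
      rwa [star_mul, hP.isSelfAdjoint.star_eq, hQ.isSelfAdjoint.star_eq, star_zero] at this
    simpa only [Matrix.add_mul, ← Matrix.mul_kronecker_mul, hQP, hP.isIdempotentElem.eq,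
      Matrix.mul_one, Matrix.kronecker_zero, add_zero, Matrix.zero_mul] using this
  have hMQ : M.map star ⊗ₖ Q = 0 := by rwa [hMP, zero_add] at h0
  by_contra hM0
  obtain ⟨a, b, hab⟩ : ∃ a b, M a b ≠ 0 := by
    by_contra! h
    exact hM0 (Matrix.ext h)
  refine hne ⟨Matrix.ext fun x y => ?_, Matrix.ext fun x y => ?_⟩
  · simpa [hab] using congrFun (congrFun hMP (a, x)) (b, y)
  · simpa [hab] using congrFun (congrFun hMQ (a, x)) (b, y)

theorem isLocalSubspaceEncoding_of_form
    (V : (j : Fin n) → Matrix (Fin (d' j)) (Fin (d j) × Fin (e j)) ℂ)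
    (P Q : Matrix (Idx e) (Idx e) ℂ) (hV : ∀ j, (V j)ᴴ * V j = 1)
    (hP : IsStarProjection P) (hQ : IsStarProjection Q) (hPQ : P * Q = 0)
    (hloc : LocallyDistinguishable P Q) (hne : ¬ (P = 0 ∧ Q = 0)) :
    IsLocalSubspaceEncoding fun M : Matrix (Idx d) (Idx d) ℂ =>
      tensorPaired V * (M ⊗ₖ P + M.map star ⊗ₖ Q) * (tensorPaired V)ᴴ := by
  have hTT := tensorPaired_conjTranspose_mul_self V hV
  refine ⟨isSubspaceEncoding_of_injective (encodingHom _ hTT P Q hP hQ hPQ)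
    (encodingHom_injective _ hTT P Q hP hQ hPQ hne), fun j A hA => ?_⟩
  obtain ⟨p, q, hp, hq, hpq, hpP, hqQ⟩ := hloc j
  have hp' : pᴴ = p := hp.isSelfAdjoint
  have hq' : qᴴ = q := hq.isSelfAdjoint
  have hqp : q * p = 0 := by
    have := congrArg star hpq
    rwa [star_mul, hp.isSelfAdjoint.star_eq, hq.isSelfAdjoint.star_eq, star_zero] at this
  have hpQ : onSite j p * Q = 0 := by
    rw [← hqQ, ← Matrix.mul_assoc, ← onSite_mul, hpq, onSite_zero, Matrix.zero_mul]
  have hqP : onSite j q * P = 0 := by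
    rw [← hpP, ← Matrix.mul_assoc, ← onSite_mul, hqp, onSite_zero, Matrix.zero_mul]
  -- The local projections `p` and `q` tell the branches apart at site `j`, so `A` is applied on the
  -- branch `P` and its conjugate on the branch `Q`.
  refine ⟨V j * (A ⊗ₖ p + A.map star ⊗ₖ q) * (V j)ᴴ, ?_, ?_⟩
  · have h : (A.map star)ᴴ = A.map star := by rw [conjTranspose_map_star, hA.eq]
    simp only [Matrix.IsHermitian, Matrix.conjTranspose_mul, Matrix.conjTranspose_conjTranspose,
      Matrix.conjTranspose_add, Matrix.conjTranspose_kronecker, hA.eq, h, hp', hq',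
      Matrix.mul_assoc]
  · have hint : ∀ (B : Matrix (Fin (d j)) (Fin (d j)) ℂ) (r : Matrix (Fin (e j)) (Fin (e j)) ℂ),
        onSite j (V j * (B ⊗ₖ r) * (V j)ᴴ) * tensorPaired V =
          tensorPaired V * (onSite j B ⊗ₖ onSite j r) := fun B r =>
      onSite_mul_tensorPaired_of_intertwine j V _ _ _
        (by rw [Matrix.mul_assoc, hV, Matrix.mul_one])
    have h1 : (1 : Matrix (Idx d) (Idx d) ℂ).map star = 1 :=
      Matrix.map_one _ (star_zero _) (star_one _)
    have hint2 : onSite j (V j * (A ⊗ₖ p + A.map star ⊗ₖ q) * (V j)ᴴ) * tensorPaired V =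
        tensorPaired V * (onSite j A ⊗ₖ onSite j p + onSite j (A.map star) ⊗ₖ onSite j q) := by
      rw [Matrix.mul_add, Matrix.add_mul, onSite_add, Matrix.add_mul, hint, hint, ← Matrix.mul_add]
    have hprod : (onSite j A ⊗ₖ onSite j p + onSite j (A.map star) ⊗ₖ onSite j q) *
        ((1 : Matrix (Idx d) (Idx d) ℂ) ⊗ₖ P + 1 ⊗ₖ Q) =
          onSite j A ⊗ₖ P + (onSite j A).map star ⊗ₖ Q := by
      simp only [Matrix.mul_add, Matrix.add_mul, ← Matrix.mul_kronecker_mul, hpP, hqQ, hpQ, hqP,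
        Matrix.mul_one, Matrix.kronecker_zero, add_zero, zero_add, onSite_map_star]
    beta_reduce
    rw [h1, ← hprod, ← Matrix.mul_assoc, ← Matrix.mul_assoc, ← Matrix.mul_assoc,
      hint2]

end Converse

end HamEnc

theorem mainTheorem8 (n : ℕ) (d d' : Fin n → ℕ) (hd : ∀ j, 2 ≤ d j)
    (E : Matrix (HamEnc.Idx d) (HamEnc.Idx d) ℂ → Matrix (HamEnc.Idx d') (HamEnc.Idx d') ℂ) :
    HamEnc.IsLocalSubspaceEncoding E ↔
      ∃ (e : Fin n → ℕ)
        (V : (j : Fin n) → Matrix (Fin (d' j)) (Fin (d j) × Fin (e j)) ℂ)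
        (P Q : Matrix (HamEnc.Idx e) (HamEnc.Idx e) ℂ),
        (∀ j, (V j)ᴴ * V j = 1) ∧
        IsStarProjection P ∧ IsStarProjection Q ∧ P * Q = 0 ∧
        HamEnc.LocallyDistinguishable P Q ∧
        ¬ (P = 0 ∧ Q = 0) ∧
        ∀ M, E M = HamEnc.tensorPaired V * (M ⊗ₖ P + M.map star ⊗ₖ Q) *
          (HamEnc.tensorPaired V)ᴴ := by
  refine ⟨fun hE => hE.exists_form hd, ?_⟩
  rintro ⟨e, V, P, Q, hV, hP, hQ, hPQ, hloc, hne, hE⟩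
  rw [funext hE]
  exact HamEnc.isLocalSubspaceEncoding_of_form V P Q hV hP hQ hPQ hloc hne
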